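/- **Setting.** A (normalized) Gaussian tree $T$ on a finite node set $V$ is a tree with vertex set $V$ and a weight $w_e\in(-1,1)$ on each edge $e$. It represents the distribution $N(0,\Sigma_T)$, where $(\Sigma_T)_{uv}$ is the product of the weights of the edges on the path from $u$ to $v$ in $T$ (so $(\Sigma_T)_{uu}=1$). For covariance matrices $\Sigma_1,\Sigma_2$ of size $N=|V|$ let $$D(\Sigma_1\|\Sigma_2)=\tfrac12\ln\frac{|\Sigma_2|}{|\Sigma_1|}+\tfrac12\operatorname{tr}(\Sigma_2^{-1}\Sigma_1)-\tfrac N2,\qquad \Sigma_\lambda^{-1}=\lambda\Sigma_1^{-1}+(1-\lambda)\Sigma_2^{-1}.$$ The Chernoff information is $CI(\Sigma_1\|\Sigma_2)=D(\Sigma_{\lambda^*}\|\Sigma_2)=D(\Sigma_{\lambda^*}\|\Sigma_1)$, where $\lambda^*\in[0,1]$ is a point at which the last equality holds. Write $CI(T\|T')=CI(\Sigma_T\|\Sigma_{T'})$. A *grafting operation* $(i,p,q)$, $p\ne q$, turns a Gaussian tree $T$ into a Gaussian tree $T'$ by replacing an edge $ip$ of $T$ by the edge $iq$ with the same weight; all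 other edges and weights are kept. A *chain of independent grafting operations* is a sequence $T_1\leftrightarrow T_2\leftrightarrow\dots\leftrightarrow T_n$ ($n\ge1$) of Gaussian trees on $V$, in which $T_{k+1}$ is obtained from $T_k$ by one grafting operation $(i_k,p_k,q_k)$, such that $V$ is the disjoint union of non-empty sets $C$ (the center) and $L_1,\dots,L_m$ (the super leaf nodes), $m\ge0$, with these properties. Each of $C,L_1,\dots,L_m$ induces a connected subgraph of $T_1$, and $T_1$ has no edge between $L_a$ and $L_b$ for $a\neq b$. Each operation is of one of three types: 1. $i_k,p_k,q_k\in L_a$ for some $a$ (it involves $L_a$); 2. $i_k\in C$ and $p_k,q_k\in L_a$ for some $a$ (it involves $L_a$); 3. $i_k,p_k\in L_a$ and $q_k\in L_b$ for some $a\ne b$ (it involves $L_a$ and $L_b$). No super leaf node is involved in two different operations. **Proposition.** Let $T_1\leftrightarrow T_2\leftrightarrow\dots\leftrightarrow T_n$ be a chain of independent grafting operations. Then all the Chernoff informations $CI(T_i\|T_j)$ are well defined (a point $\lambda^*$ exists, and the value does not depend on its choice), and $$CI(T_i\|T_j)\le CI(T_p\|T_q)\qquad\text{whenever } p\le i\le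 j\le q .$$ -/

import Mathlib

/-- A normalized Gaussian tree on the node set `V`: a tree together with a weight (correlation) on
each edge. Weights lie in `(-1, 1)`, so that the covariance matrix is non-singular. The values of
`weight` outside the edge set are never used. -/
structure GaussianTree (V : Type*) where
  graph : SimpleGraph V
  isTree : graph.IsTree
  weight : Sym2 V → ℝ
  abs_weight_lt_one : ∀ e ∈ graph.edgeSet, |weight e| < 1

namespace GaussianTree

/-- The normalized covariance matrix: `σ i j` is the product of the edge weights along the unique
path from `i` to `j` (hence `1` if `i = j`, and the weight of the edge if `i`, `j` are adjacent). -/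
noncomputable def cov {V : Type*} (T : GaussianTree V) : Matrix V V ℝ :=
  Matrix.of fun i j => ((T.isTree.existsUnique_path i j).choose.edges.map T.weight).prod

theorem cov_eq_of_isPath {V : Type*} (T : GaussianTree V) {i j : V} (w : T.graph.Walk i j)
    (hw : w.IsPath) : T.cov i j = (w.edges.map T.weight).prod := by
  have h := (T.isTree.existsUnique_path i j).choose_spec.2 w hw
  rw [cov, Matrix.of_apply, h]

/-- `T'` is obtained from `T` by a grafting operation: the edge `i — p` is cut, and the edge
`i — q`, `q ≠ p`, is added with the same weight. All other edges and weights are unchanged.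
(As `T'` is a tree, `q` lies in the component of `p` after the cut.) -/
structure IsGrafting {V : Type*} (T T' : GaussianTree V) (i p q : V) : Prop where
  adj : T.graph.Adj i p
  ne : p ≠ q
  edgeSet_eq : T'.graph.edgeSet = insert s(i, q) (T.graph.edgeSet \ {s(i, p)})
  weight_new : T'.weight s(i, q) = T.weight s(i, p)
  weight_eq : ∀ e ∈ T.graph.edgeSet, e ≠ s(i, p) → T'.weight e = T.weight e

end GaussianTree

/-- The nodes of `G` are grouped into a star: a central subtree `C`, and disjoint subtrees
`L 0, …, L (m - 1)` (the super leaf nodes), no two of which are joined by an edge. In a tree,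
each super leaf node is then joined to the center by exactly one edge. -/
structure IsStarDecomposition {V : Type*} (G : SimpleGraph V) (C : Set V) {m : ℕ}
    (L : Fin m → Set V) : Prop where
  center_connected : (G.induce C).Connected
  leaf_connected : ∀ a, (G.induce (L a)).Connected
  center_disjoint : ∀ a, Disjoint C (L a)
  leaf_disjoint : ∀ a b, a ≠ b → Disjoint (L a) (L b)
  cover : C ∪ ⋃ a, L a = Set.univ
  leaf_not_adj : ∀ a b, a ≠ b → ∀ u ∈ L a, ∀ v ∈ L b, ¬ G.Adj u v

/-- `InvolvesSuperLeaves C L i p q A`: the operation "cut the edge `i — p`, add the edge `i — q`"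
is of one of the three types below, and the super leaf nodes involved are those indexed by `A`. -/
inductive InvolvesSuperLeaves {V : Type*} (C : Set V) {m : ℕ} (L : Fin m → Set V) (i p q : V) :
    Set (Fin m) → Prop
  /-- First type: a subtree of a super leaf node is moved inside this super leaf node. -/
  | within (a : Fin m) (hi : i ∈ L a) (hp : p ∈ L a) (hq : q ∈ L a) :
      InvolvesSuperLeaves C L i p q {a}
  /-- Second type: the subtree outside a super leaf node is cut from this super leaf node and pasted
  to another location in it. -/
  | outside (a : Fin m) (hi : i ∈ C) (hp : p ∈ L a) (hq : q ∈ L a) :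
      InvolvesSuperLeaves C L i p q {a}
  /-- Third type: a subtree is cut from one super leaf node and pasted to another one. -/
  | between (a b : Fin m) (hab : a ≠ b) (hi : i ∈ L a) (hp : p ∈ L a) (hq : q ∈ L b) :
      InvolvesSuperLeaves C L i p q {a, b}

/-- `T 0 ↔ T 1 ↔ ⋯ ↔ T n` is a chain of independent grafting operations: each tree is obtained from
the previous one by one grafting operation, and for one star decomposition the operations are of
the three types and involve pairwise disjoint sets of super leaf nodes. The center is unchanged by
every operation, and the super leaf nodes of an operation are unchanged before that operation, so
it is enough to ask for the decomposition in the first tree. -/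
def IsIndependentGraftingChain {V : Type*} {n : ℕ} (T : Fin (n + 1) → GaussianTree V) : Prop :=
  ∃ (m : ℕ) (C : Set V) (L : Fin m → Set V) (A : Fin n → Set (Fin m)),
    IsStarDecomposition (T 0).graph C L ∧
    (∀ k l, k ≠ l → Disjoint (A k) (A l)) ∧
    ∀ k : Fin n, ∃ i p q : V,
      (T k.castSucc).IsGrafting (T k.succ) i p q ∧ InvolvesSuperLeaves C L i p q (A k)

/-- Kullback–Leibler divergence `D(N(0, S₁) ‖ N(0, S₂))`. -/
noncomputable def gaussianKL {V : Type*} [Fintype V] [DecidableEq V] (S₁ S₂ : Matrix V V ℝ) : ℝ :=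
  1 / 2 * Real.log (S₂.det / S₁.det) + 1 / 2 * (S₂⁻¹ * S₁).trace - (Fintype.card V : ℝ) / 2

/-- The matrix `S_l` of the exponential family joining `N(0, S₁)` and `N(0, S₂)`:
`S_l⁻¹ = l S₁⁻¹ + (1 - l) S₂⁻¹`. -/
noncomputable def interpolatedCov {V : Type*} [Fintype V] [DecidableEq V] (S₁ S₂ : Matrix V V ℝ)
    (l : ℝ) : Matrix V V ℝ :=
  (l • S₁⁻¹ + (1 - l) • S₂⁻¹)⁻¹

/-- `c = D(S_l ‖ S₂) = D(S_l ‖ S₁)` for some `l ∈ [0, 1]`. -/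
def IsChernoffInfo {V : Type*} [Fintype V] [DecidableEq V] (S₁ S₂ : Matrix V V ℝ) (c : ℝ) : Prop :=
  ∃ l ∈ Set.Icc (0 : ℝ) 1,
    gaussianKL (interpolatedCov S₁ S₂ l) S₂ = c ∧ gaussianKL (interpolatedCov S₁ S₂ l) S₁ = c

/-- Chernoff information `CI(S₁ ‖ S₂)`: the value `c` such that `IsChernoffInfo S₁ S₂ c`. -/
noncomputable def chernoffInfo {V : Type*} [Fintype V] [DecidableEq V] (S₁ S₂ : Matrix V V ℝ) : ℝ :=
  Classical.epsilon (IsChernoffInfo S₁ S₂)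

/-! Write `P₁`, `P₂` for the precision (inverse covariance) matrices. The Chernoff information is
the maximum over `l ∈ [0, 1]` of `chernoffExponent P₁ P₂ l`, that is, half of `log |l P₁ + (1 - l)
P₂| - l log |P₁| - (1 - l) log |P₂|`. Grafting preserves determinants, so it suffices to show, for
each fixed `l`, that the determinant of the mixture does not decrease when the index interval is
enlarged by one step at either end.

An edge adds a rank-two block to the precision matrix. Suppose that under `X` the node `x` has unit
variance and is uncorrelated with `y`. Then attaching the edge `x — y` is a congruence of `X` whose
effect on the determinant depends only on the weight (`exists_add_edgeMatrix_eq`). This condition on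
`X` follows from linear equations `X g = e_x` with a fixed vector `g`. For an operation at a super
leaf node, `g` can be chosen supported inside that node, so all earlier trees, with the old edge
removed, satisfy the same equations, and so do all later trees with the new edge removed. The
equations cut out a convex set `R`, hence mixtures stay in it
(`GaussianTree.IsGrafting.exists_convex_remainders`).

Thus for `i ≤ k` the mixture of trees `i` and `k` is `X + K` with `X ∈ R`. Replacing tree `k` by
tree `k + 1` turns it into a mixture of `X + K` and `X + K'`, two positive definite matrices of
equal determinant. Log-concavity of the determinant (`Matrix.PosDef.det_le_det_convexComb`) gives
the inequality; the left end is symmetric. -/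

/-! ### Log-concavity of the determinant. -/

theorem Matrix.PosDef.log_det_le_trace_sub_card {n : Type*} [Fintype n] [DecidableEq n]
    {Y : Matrix n n ℝ} (hY : Y.PosDef) : Real.log Y.det ≤ Y.trace - Fintype.card n := by
  have hdet : Y.det = ∏ i, hY.isHermitian.eigenvalues i := by
    simpa using hY.isHermitian.det_eq_prod_eigenvalues
  have htr : Y.trace = ∑ i, hY.isHermitian.eigenvalues i := by
    simpa using hY.isHermitian.trace_eq_sum_eigenvalues
  rw [hdet, htr, Real.log_prod fun i _ => (hY.eigenvalues_pos i).ne']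
  calc ∑ i, Real.log (hY.isHermitian.eigenvalues i)
      ≤ ∑ i, (hY.isHermitian.eigenvalues i - 1) :=
        Finset.sum_le_sum fun i _ => Real.log_le_sub_one_of_pos (hY.eigenvalues_pos i)
    _ = _ := by simp

-- Factor `P = B* B` and apply the trace bound to the congruent matrix `B Q B*`, which has the
-- determinant and the trace of `P Q`.
open scoped MatrixOrder in
theorem Matrix.PosDef.log_det_add_log_det_le {n : Type*} [Fintype n] [DecidableEq n]
    {P Q : Matrix n n ℝ} (hP : P.PosDef) (hQ : Q.PosDef) :
    Real.log P.det + Real.log Q.det ≤ (P * Q).trace - Fintype.card n := by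
  obtain ⟨B, hB⟩ := CStarAlgebra.nonneg_iff_eq_star_mul_self.mp hP.posSemidef.nonneg
  have hdet : P.det = B.det * B.det := by
    rw [hB, Matrix.det_mul, Matrix.star_eq_conjTranspose, Matrix.det_conjTranspose]; simp
  have hB0 : B.det ≠ 0 := fun h => hP.det_pos.ne' (by rw [hdet, h, zero_mul])
  have hBu : IsUnit B := (Matrix.isUnit_iff_isUnit_det B).2 (isUnit_iff_ne_zero.2 hB0)
  have hY : (B * Q * star B).PosDef := (Matrix.IsUnit.posDef_star_right_conjugate_iff hBu).2 hQ
  have h := hY.log_det_le_trace_sub_card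
  have htr : (B * Q * star B).trace = (P * Q).trace := by
    rw [hB, Matrix.trace_mul_comm, ← Matrix.mul_assoc]
  have hd : (B * Q * star B).det = P.det * Q.det := by
    rw [hdet, Matrix.det_mul, Matrix.det_mul, Matrix.star_eq_conjTranspose,
      Matrix.det_conjTranspose]
    simp only [star_trivial]; ring
  rwa [htr, hd, Real.log_mul hP.det_pos.ne' hQ.det_pos.ne'] at h

theorem Matrix.PosDef.convexComb {n : Type*} [Fintype n] [DecidableEq n]
    {X Y : Matrix n n ℝ} (hX : X.PosDef) (hY : Y.PosDef) {l : ℝ} (hl : l ∈ Set.Icc (0 : ℝ) 1) :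
    (l • X + (1 - l) • Y).PosDef := by
  rcases hl.1.eq_or_lt with rfl | h0
  · simpa using hY
  · exact (hX.smul h0).add_posSemidef (hY.posSemidef.smul (by linarith [hl.2]))

/-- Log-concavity of the determinant on positive definite matrices. -/
theorem Matrix.PosDef.log_det_convexComb {n : Type*} [Fintype n] [DecidableEq n]
    {X Y : Matrix n n ℝ} (hX : X.PosDef) (hY : Y.PosDef) {l : ℝ} (hl : l ∈ Set.Icc (0 : ℝ) 1) :
    l * Real.log X.det + (1 - l) * Real.log Y.det ≤ Real.log (l • X + (1 - l) • Y).det := by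
  have hZ := hX.convexComb hY hl
  set Z := l • X + (1 - l) • Y with hZdef
  -- Tangent inequalities for `log det` at the mixture `Z`; in their weighted sum the trace terms
  -- cancel the dimension.
  have h1 := hX.log_det_add_log_det_le hZ.inv
  have h2 := hY.log_det_add_log_det_le hZ.inv
  have htr : l * (X * Z⁻¹).trace + (1 - l) * (Y * Z⁻¹).trace = Fintype.card n := by
    have h : Z * Z⁻¹ = 1 := Matrix.mul_nonsing_inv _ (isUnit_iff_ne_zero.2 hZ.det_pos.ne')
    have h' := congrArg Matrix.trace h
    nth_rewrite 1 [hZdef] at h'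
    simpa [Matrix.add_mul, Matrix.trace_add, Matrix.trace_smul] using h'
  have hlog : Real.log Z⁻¹.det = -Real.log Z.det := by
    rw [Matrix.det_nonsing_inv, Ring.inverse_eq_inv', Real.log_inv]
  rw [hlog] at h1 h2
  have := mul_le_mul_of_nonneg_left h1 hl.1
  have := mul_le_mul_of_nonneg_left h2 (sub_nonneg.2 hl.2)
  nlinarith

theorem Matrix.PosDef.det_le_det_convexComb {n : Type*} [Fintype n] [DecidableEq n]
    {X Y : Matrix n n ℝ} (hX : X.PosDef) (hY : Y.PosDef) (h : X.det = Y.det) {l : ℝ}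
    (hl : l ∈ Set.Icc (0 : ℝ) 1) : X.det ≤ (l • X + (1 - l) • Y).det := by
  have h1 := hX.log_det_convexComb hY hl
  rw [← h] at h1
  exact (Real.log_le_log_iff hX.det_pos (hX.convexComb hY hl).det_pos).1 (by linarith)

/-! ### Chernoff information as a maximum of exponents. -/

section Chernoff

variable {V : Type*} [Fintype V] [DecidableEq V]

theorem Matrix.log_det_inv {S : Matrix V V ℝ} : Real.log S⁻¹.det = -Real.log S.det := by
  rw [Matrix.det_nonsing_inv, Ring.inverse_eq_inv', Real.log_inv]

theorem gaussianKL_eq {Q S : Matrix V V ℝ} (hQ : Q.PosDef) (hS : S.PosDef) :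
    gaussianKL Q S = 1 / 2 * (-Real.log S⁻¹.det - Real.log Q.det + (S⁻¹ * Q).trace -
      Fintype.card V) := by
  rw [gaussianKL, Real.log_div hS.det_pos.ne' hQ.det_pos.ne', Matrix.log_det_inv]
  ring

theorem gaussianKL_nonneg {Q S : Matrix V V ℝ} (hQ : Q.PosDef) (hS : S.PosDef) :
    0 ≤ gaussianKL Q S := by
  have := hS.inv.log_det_add_log_det_le hQ
  rw [gaussianKL_eq hQ hS]
  linarith

theorem gaussianKL_self {S : Matrix V V ℝ} (hS : S.PosDef) : gaussianKL S S = 0 := by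
  have hu : IsUnit S.det := isUnit_iff_ne_zero.2 hS.det_pos.ne'
  simp [gaussianKL, Matrix.nonsing_inv_mul S hu, hS.det_pos.ne']
  ring

/-- The Chernoff coefficient exponent at the parameter `l`, in terms of precision matrices. -/
noncomputable def chernoffExponent (P₁ P₂ : Matrix V V ℝ) (l : ℝ) : ℝ :=
  1 / 2 * (Real.log (l • P₁ + (1 - l) • P₂).det - l * Real.log P₁.det -
    (1 - l) * Real.log P₂.det)

theorem interpolatedCov_posDef {S₁ S₂ : Matrix V V ℝ} (h₁ : S₁.PosDef) (h₂ : S₂.PosDef) {l : ℝ}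
    (hl : l ∈ Set.Icc (0 : ℝ) 1) : (interpolatedCov S₁ S₂ l).PosDef :=
  (h₁.inv.convexComb h₂.inv hl).inv

/-- The cross term is linear in the precision matrix, so averaging over `S₁`, `S₂` yields the
divergence from the interpolated matrix plus a constant independent of `Q`. With `Q` the equidistant
point, nonnegativity of the divergence makes its value an upper bound for all exponents, attained at
its own parameter. -/
theorem convexComb_gaussianKL {Q S₁ S₂ : Matrix V V ℝ} (hQ : Q.PosDef) (h₁ : S₁.PosDef)
    (h₂ : S₂.PosDef) {l : ℝ} (hl : l ∈ Set.Icc (0 : ℝ) 1) :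
    l * gaussianKL Q S₁ + (1 - l) * gaussianKL Q S₂ =
      chernoffExponent S₁⁻¹ S₂⁻¹ l + gaussianKL Q (interpolatedCov S₁ S₂ l) := by
  have hu := (h₁.inv.convexComb h₂.inv hl)
  have hinv : (interpolatedCov S₁ S₂ l)⁻¹ = l • S₁⁻¹ + (1 - l) • S₂⁻¹ :=
    Matrix.nonsing_inv_nonsing_inv _ (isUnit_iff_ne_zero.2 hu.det_pos.ne')
  rw [gaussianKL_eq hQ h₁, gaussianKL_eq hQ h₂, gaussianKL_eq hQ (interpolatedCov_posDef h₁ h₂ hl),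
    hinv, chernoffExponent]
  simp only [Matrix.add_mul, Matrix.trace_add, Matrix.trace_smul, Matrix.smul_mul, smul_eq_mul]
  ring

theorem IsChernoffInfo.exponent_le {S₁ S₂ : Matrix V V ℝ} (h₁ : S₁.PosDef) (h₂ : S₂.PosDef)
    {c : ℝ} (hc : IsChernoffInfo S₁ S₂ c) {l : ℝ} (hl : l ∈ Set.Icc (0 : ℝ) 1) :
    chernoffExponent S₁⁻¹ S₂⁻¹ l ≤ c := by
  obtain ⟨m, hm, e₂, e₁⟩ := hc
  have hQ := interpolatedCov_posDef h₁ h₂ hm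
  have h := convexComb_gaussianKL hQ h₁ h₂ hl
  have h' := gaussianKL_nonneg hQ (interpolatedCov_posDef h₁ h₂ hl)
  rw [e₁, e₂] at h
  linarith

theorem IsChernoffInfo.exists_exponent_eq {S₁ S₂ : Matrix V V ℝ} (h₁ : S₁.PosDef)
    (h₂ : S₂.PosDef) {c : ℝ} (hc : IsChernoffInfo S₁ S₂ c) :
    ∃ l ∈ Set.Icc (0 : ℝ) 1, chernoffExponent S₁⁻¹ S₂⁻¹ l = c := by
  obtain ⟨m, hm, e₂, e₁⟩ := hc
  have hQ := interpolatedCov_posDef h₁ h₂ hm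
  have h := convexComb_gaussianKL hQ h₁ h₂ hm
  rw [e₁, e₂, gaussianKL_self hQ] at h
  exact ⟨m, hm, by linarith⟩

theorem continuousOn_interpolatedCov {S₁ S₂ : Matrix V V ℝ} (h₁ : S₁.PosDef) (h₂ : S₂.PosDef) :
    ContinuousOn (interpolatedCov S₁ S₂) (Set.Icc 0 1) := by
  have hcont : Continuous fun l : ℝ => l • S₁⁻¹ + (1 - l) • S₂⁻¹ := by fun_prop
  have heq : interpolatedCov S₁ S₂ = fun l => (l • S₁⁻¹ + (1 - l) • S₂⁻¹).det⁻¹ •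
      (l • S₁⁻¹ + (1 - l) • S₂⁻¹).adjugate := by
    funext l
    rw [interpolatedCov, Matrix.inv_def, Ring.inverse_eq_inv']
  rw [heq]
  exact ContinuousOn.smul (hcont.matrix_det.continuousOn.inv₀ fun l hl =>
    (h₁.inv.convexComb h₂.inv hl).det_pos.ne') hcont.matrix_adjugate.continuousOn

theorem continuousOn_gaussianKL_interpolatedCov {S₁ S₂ S : Matrix V V ℝ} (h₁ : S₁.PosDef)
    (h₂ : S₂.PosDef) (hS : S.PosDef) :
    ContinuousOn (fun l => gaussianKL (interpolatedCov S₁ S₂ l) S) (Set.Icc 0 1) := by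
  have hc := continuousOn_interpolatedCov h₁ h₂
  have hdet : ContinuousOn (fun l => (interpolatedCov S₁ S₂ l).det) (Set.Icc 0 1) :=
    (continuous_id.matrix_det).comp_continuousOn hc
  have htr : ContinuousOn (fun l => (S⁻¹ * interpolatedCov S₁ S₂ l).trace) (Set.Icc 0 1) :=
    ((continuous_const.matrix_mul continuous_id).matrix_trace).comp_continuousOn hc
  have hlog : ContinuousOn (fun l => Real.log (S.det / (interpolatedCov S₁ S₂ l).det))
      (Set.Icc 0 1) := by
    refine ContinuousOn.log (continuousOn_const.div hdet fun l hl => ?_) fun l hl => ?_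
    · exact (interpolatedCov_posDef h₁ h₂ hl).det_pos.ne'
    · exact (div_pos hS.det_pos (interpolatedCov_posDef h₁ h₂ hl).det_pos).ne'
  exact ((continuousOn_const.mul hlog).add (continuousOn_const.mul htr)).sub continuousOn_const

/-- Existence is the intermediate value theorem: the difference of the two divergences is `-D(S₂ ‖
S₁)` at `l = 0` and `D(S₁ ‖ S₂)` at `l = 1`. Uniqueness holds because every admissible value is the
maximal exponent. -/
theorem existsUnique_isChernoffInfo {S₁ S₂ : Matrix V V ℝ} (h₁ : S₁.PosDef) (h₂ : S₂.PosDef) :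
    ∃! c, IsChernoffInfo S₁ S₂ c := by
  have hi₁ : S₁⁻¹⁻¹ = S₁ := Matrix.nonsing_inv_nonsing_inv _ (isUnit_iff_ne_zero.2 h₁.det_pos.ne')
  have hi₂ : S₂⁻¹⁻¹ = S₂ := Matrix.nonsing_inv_nonsing_inv _ (isUnit_iff_ne_zero.2 h₂.det_pos.ne')
  have hcont : ContinuousOn (fun l => gaussianKL (interpolatedCov S₁ S₂ l) S₂ -
      gaussianKL (interpolatedCov S₁ S₂ l) S₁) (Set.Icc 0 1) :=
    (continuousOn_gaussianKL_interpolatedCov h₁ h₂ h₂).sub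
      (continuousOn_gaussianKL_interpolatedCov h₁ h₂ h₁)
  have h0 : gaussianKL (interpolatedCov S₁ S₂ 0) S₂ -
      gaussianKL (interpolatedCov S₁ S₂ 0) S₁ ≤ 0 := by
    simp [interpolatedCov, hi₂, gaussianKL_self h₂, gaussianKL_nonneg h₂ h₁]
  have h1 : 0 ≤ gaussianKL (interpolatedCov S₁ S₂ 1) S₂ -
      gaussianKL (interpolatedCov S₁ S₂ 1) S₁ := by
    simp [interpolatedCov, hi₁, gaussianKL_self h₁, gaussianKL_nonneg h₁ h₂]
  obtain ⟨l, hl, hl0⟩ := intermediate_value_Icc zero_le_one hcont ⟨h0, h1⟩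
  refine ⟨gaussianKL (interpolatedCov S₁ S₂ l) S₂, ⟨l, hl, rfl, (sub_eq_zero.1 hl0).symm⟩, ?_⟩
  have key : ∀ c d, IsChernoffInfo S₁ S₂ c → IsChernoffInfo S₁ S₂ d → c ≤ d := by
    intro c d hc hd
    obtain ⟨m, hm, rfl⟩ := hc.exists_exponent_eq h₁ h₂
    exact hd.exponent_le h₁ h₂ hm
  have hex : IsChernoffInfo S₁ S₂ (gaussianKL (interpolatedCov S₁ S₂ l) S₂) :=
    ⟨l, hl, rfl, (sub_eq_zero.1 hl0).symm⟩
  exact fun c hc => le_antisymm (key _ _ hc hex) (key _ _ hex hc)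

theorem isChernoffInfo_chernoffInfo {S₁ S₂ : Matrix V V ℝ} (h₁ : S₁.PosDef) (h₂ : S₂.PosDef) :
    IsChernoffInfo S₁ S₂ (chernoffInfo S₁ S₂) :=
  Classical.epsilon_spec (existsUnique_isChernoffInfo h₁ h₂).exists

theorem chernoffInfo_le_of_exponent_le {S₁ S₂ S₃ S₄ : Matrix V V ℝ} (h₁ : S₁.PosDef)
    (h₂ : S₂.PosDef) (h₃ : S₃.PosDef) (h₄ : S₄.PosDef)
    (h : ∀ l ∈ Set.Icc (0 : ℝ) 1, chernoffExponent S₁⁻¹ S₂⁻¹ l ≤ chernoffExponent S₃⁻¹ S₄⁻¹ l) :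
    chernoffInfo S₁ S₂ ≤ chernoffInfo S₃ S₄ := by
  obtain ⟨l, hl, e⟩ := (isChernoffInfo_chernoffInfo h₁ h₂).exists_exponent_eq h₁ h₂
  rw [← e]
  exact (h l hl).trans ((isChernoffInfo_chernoffInfo h₃ h₄).exponent_le h₃ h₄ hl)

end Chernoff

/-! ### Edge contributions to the precision matrix. -/

section EdgeMatrix

variable {V : Type*} [DecidableEq V]

/-- The contribution of an edge of weight `w` between `x` and `y` to the precision matrix. -/
noncomputable def edgeMatrix (x y : V) (w : ℝ) : Matrix V V ℝ :=
  Matrix.of fun u v => w ^ 2 / (1 - w ^ 2) *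
    (Pi.single (M := fun _ => ℝ) x 1 u * Pi.single (M := fun _ => ℝ) x 1 v +
      Pi.single (M := fun _ => ℝ) y 1 u * Pi.single (M := fun _ => ℝ) y 1 v) -
    w / (1 - w ^ 2) *
    (Pi.single (M := fun _ => ℝ) x 1 u * Pi.single (M := fun _ => ℝ) y 1 v +
      Pi.single (M := fun _ => ℝ) y 1 u * Pi.single (M := fun _ => ℝ) x 1 v)

theorem one_sub_sq_pos_of_abs_lt_one {w : ℝ} (hw : |w| < 1) : 0 < 1 - w ^ 2 :=
  sub_pos.2 ((sq_lt_one_iff_abs_lt_one w).2 hw)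

variable [Fintype V]

/-- Joining a node `x` of unit variance to an independent node `y` by an edge is a congruence. -/
theorem exists_add_edgeMatrix_eq {X : Matrix V V ℝ} (hX : X.IsSymm) {x y : V} {g : V → ℝ}
    (hg : X.mulVec g = Pi.single x 1) (hx : g x = 1) (hy : g y = 0) {w : ℝ} (hw : |w| < 1) :
    ∃ W : Matrix V V ℝ, W.det ^ 2 = (1 - w ^ 2)⁻¹ ∧ X + edgeMatrix x y w = star W * X * W := by
  have hw' := one_sub_sq_pos_of_abs_lt_one hw
  obtain ⟨s, hs⟩ : ∃ s : ℝ, s ^ 2 = (1 - w ^ 2)⁻¹ :=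
    ⟨√((1 - w ^ 2)⁻¹), Real.sq_sqrt (inv_nonneg.2 hw'.le)⟩
  -- Chosen so that `h + e_x = s (e_x - w e_y)`. With `W = 1 + g hᵀ` one gets `Wᵀ X W = X + (h +
  -- e_x)(h + e_x)ᵀ - e_x e_xᵀ`, and `det W = 1 + h ⬝ g = s`.
  set h : V → ℝ := (s - 1) • Pi.single x 1 - (w * s) • Pi.single y 1 with hh
  have hg' : Matrix.vecMul g X = Pi.single x 1 := by
    rw [← hX.eq, Matrix.vecMul_transpose, hg]
  have hgXg : (Pi.single x 1 : V → ℝ) ⬝ᵥ g = 1 := by simp [hx]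
  refine ⟨1 + Matrix.vecMulVec g h, ?_, ?_⟩
  · rw [Matrix.vecMulVec_eq Unit, Matrix.det_one_add_replicateCol_mul_replicateRow]
    have : h ⬝ᵥ g = s - 1 := by
      simp [hh, sub_dotProduct, smul_dotProduct, hx, hy]
    rw [this, ← hs]
    ring
  · have hst : star (1 + Matrix.vecMulVec g h) = 1 + Matrix.vecMulVec h g := by
      rw [Matrix.star_eq_conjTranspose, Matrix.conjTranspose_eq_transpose_of_trivial]
      simp [Matrix.transpose_vecMulVec]
    rw [hst, add_mul, one_mul, mul_add, mul_one, Matrix.mul_vecMulVec, Matrix.add_mulVec, hg,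
      Matrix.vecMulVec_mul, hg', Matrix.vecMulVec_mulVec, hgXg]
    ext u v
    simp only [edgeMatrix, Matrix.add_apply, Matrix.of_apply, Matrix.vecMulVec_apply, hh,
      Pi.add_apply, Pi.sub_apply, Pi.smul_apply, smul_eq_mul, MulOpposite.op_one, one_smul]
    generalize Pi.single (M := fun _ => ℝ) x 1 u = xu
    generalize Pi.single (M := fun _ => ℝ) x 1 v = xv
    generalize Pi.single (M := fun _ => ℝ) y 1 u = yu
    generalize Pi.single (M := fun _ => ℝ) y 1 v = yv
    have e1 : w ^ 2 / (1 - w ^ 2) = s ^ 2 - 1 := by rw [hs]; field_simp; ring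
    have e2 : w / (1 - w ^ 2) = w * s ^ 2 := by rw [hs]; field_simp
    have e3 : w ^ 2 * s ^ 2 = s ^ 2 - 1 := by rw [hs]; field_simp; ring
    rw [e1, e2]
    linear_combination (-yu * yv) * e3

theorem det_add_edgeMatrix {X : Matrix V V ℝ} (hX : X.IsSymm) {x y : V} {g : V → ℝ}
    (hg : X.mulVec g = Pi.single x 1) (hx : g x = 1) (hy : g y = 0) {w : ℝ} (hw : |w| < 1) :
    (X + edgeMatrix x y w).det = (1 - w ^ 2)⁻¹ * X.det := by
  obtain ⟨W, hW, e⟩ := exists_add_edgeMatrix_eq hX hg hx hy hw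
  rw [e, Matrix.det_mul, Matrix.det_mul, Matrix.star_eq_conjTranspose, Matrix.det_conjTranspose,
    star_trivial, ← hW]
  ring

theorem posDef_add_edgeMatrix_iff {X : Matrix V V ℝ} (hX : X.IsSymm) {x y : V} {g : V → ℝ}
    (hg : X.mulVec g = Pi.single x 1) (hx : g x = 1) (hy : g y = 0) {w : ℝ} (hw : |w| < 1) :
    (X + edgeMatrix x y w).PosDef ↔ X.PosDef := by
  obtain ⟨W, hW, e⟩ := exists_add_edgeMatrix_eq hX hg hx hy hw
  have hWu : IsUnit W := by
    rw [Matrix.isUnit_iff_isUnit_det, isUnit_iff_ne_zero]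
    intro h0
    have := inv_pos.2 (one_sub_sq_pos_of_abs_lt_one hw)
    rw [← hW, h0] at this
    simp at this
  rw [e, Matrix.IsUnit.posDef_star_left_conjugate_iff hWu]

/-- The precision matrix with the edge weights `ω`; pairs of weight `0` do not contribute. -/
noncomputable def precisionOf (ω : Sym2 V → ℝ) : Matrix V V ℝ :=
  Matrix.diagonal (fun u => 1 + ∑ c, ω s(u, c) ^ 2 / (1 - ω s(u, c) ^ 2)) -
    Matrix.of fun u v => ω s(u, v) / (1 - ω s(u, v) ^ 2)

theorem precisionOf_isSymm (ω : Sym2 V → ℝ) : (precisionOf ω).IsSymm := by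
  refine (Matrix.isSymm_diagonal _).sub (Matrix.IsSymm.ext fun u v => ?_)
  simp [Sym2.eq_swap]

theorem precisionOf_eq_update_add {x y : V} (hxy : x ≠ y) (ω : Sym2 V → ℝ) :
    precisionOf ω = precisionOf (Function.update ω s(x, y) 0) + edgeMatrix x y (ω s(x, y)) := by
  have key : ∀ f : ℝ → ℝ, f 0 = 0 → ∀ u v, f (ω s(u, v)) =
      f (Function.update ω s(x, y) 0 s(u, v)) + f (ω s(x, y)) *
        (Pi.single (M := fun _ => ℝ) x 1 u * Pi.single (M := fun _ => ℝ) y 1 v +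
          Pi.single (M := fun _ => ℝ) y 1 u * Pi.single (M := fun _ => ℝ) x 1 v) := by
    intro f hf u v
    by_cases h : s(u, v) = s(x, y)
    · rw [h]
      rcases Sym2.eq_iff.1 h with ⟨rfl, rfl⟩ | ⟨rfl, rfl⟩
      · simp [hf, hxy]
      · simp [hf, hxy]
    · have h1 : ¬ (u = x ∧ v = y) := fun ⟨a, b⟩ => h (by rw [a, b])
      have h2 : ¬ (u = y ∧ v = x) := fun ⟨a, b⟩ => h (by rw [a, b, Sym2.eq_swap])
      have e1 : Pi.single (M := fun _ => ℝ) x 1 u * Pi.single (M := fun _ => ℝ) y 1 v = 0 := by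
        rw [mul_eq_zero]
        by_cases hu : u = x
        · exact Or.inr (Pi.single_eq_of_ne (fun hv => h1 ⟨hu, hv⟩) _)
        · exact Or.inl (Pi.single_eq_of_ne hu _)
      have e2 : Pi.single (M := fun _ => ℝ) y 1 u * Pi.single (M := fun _ => ℝ) x 1 v = 0 := by
        rw [mul_eq_zero]
        by_cases hu : u = y
        · exact Or.inr (Pi.single_eq_of_ne (fun hv => h2 ⟨hu, hv⟩) _)
        · exact Or.inl (Pi.single_eq_of_ne hu _)
      rw [e1, e2, Function.update_of_ne h]
      ring
  ext u v
  simp only [precisionOf, Matrix.add_apply, Matrix.sub_apply, Matrix.of_apply, edgeMatrix,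
    Matrix.diagonal_apply]
  rw [key (fun t => t / (1 - t ^ 2)) (by simp) u v]
  have hs : ∑ c, ω s(u, c) ^ 2 / (1 - ω s(u, c) ^ 2) =
      ∑ c, Function.update ω s(x, y) 0 s(u, c) ^ 2 /
        (1 - Function.update ω s(x, y) 0 s(u, c) ^ 2) +
      ω s(x, y) ^ 2 / (1 - ω s(x, y) ^ 2) *
        (Pi.single (M := fun _ => ℝ) x 1 u + Pi.single (M := fun _ => ℝ) y 1 u) := by
    rw [Finset.sum_congr rfl fun c _ => key (fun t => t ^ 2 / (1 - t ^ 2)) (by simp) u c,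
      Finset.sum_add_distrib, ← Finset.mul_sum, Finset.sum_add_distrib, ← Finset.mul_sum,
      ← Finset.mul_sum]
    simp
  rw [hs]
  split_ifs with huv
  · subst huv
    have hsq : ∀ z : V, Pi.single (M := fun _ => ℝ) z 1 u * Pi.single (M := fun _ => ℝ) z 1 u =
        Pi.single (M := fun _ => ℝ) z 1 u := fun z => by
      by_cases h : u = z
      · subst h; simp
      · simp [Pi.single_eq_of_ne h]
    rw [hsq, hsq]
    ring
  · have hsq : ∀ z : V, Pi.single (M := fun _ => ℝ) z 1 u * Pi.single (M := fun _ => ℝ) z 1 v =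
        0 := fun z => by
      by_cases h : u = z
      · subst h; simp [Pi.single_eq_of_ne (Ne.symm huv)]
      · simp [Pi.single_eq_of_ne h]
    rw [hsq, hsq]
    ring

/-- The product of the precision matrix with a vector only depends on the weights of the pairs
that meet its support. -/
theorem precisionOf_mulVec_congr {ω ω' : Sym2 V → ℝ} {g : V → ℝ}
    (h : ∀ v, g v ≠ 0 → ∀ u, ω s(v, u) = ω' s(v, u)) :
    (precisionOf ω).mulVec g = (precisionOf ω').mulVec g := by
  ext u
  refine Finset.sum_congr rfl fun v _ => ?_
  by_cases hv : g v = 0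
  · simp [hv]
  · simp only [precisionOf, Matrix.sub_apply, Matrix.of_apply, Matrix.diagonal_apply]
    rw [Sym2.eq_swap, h v hv u]
    split_ifs with huv
    · subst huv
      simp only [h u hv]
    · rfl

end EdgeMatrix

/-! ### Covariance and precision matrices of a Gaussian tree. -/

namespace GaussianTree

variable {V : Type*} (T : GaussianTree V)

theorem cov_self (u : V) : T.cov u u = 1 := by
  rw [T.cov_eq_of_isPath SimpleGraph.Walk.nil SimpleGraph.Walk.IsPath.nil]
  simp

theorem cov_of_isPath_of_mem_support {u v c : V} (hc : T.graph.Adj u c) {q : T.graph.Walk u v}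
    (hq : q.IsPath) (hcq : c ∈ q.support) : T.cov u v = T.weight s(u, c) * T.cov c v := by
  have hsnd := T.isTree.isAcyclic.eq_snd_of_adj_start hq hc hcq
  cases q with
  | nil => simp only [SimpleGraph.Walk.support_nil, List.mem_singleton] at hcq
           exact absurd hcq hc.ne'
  | cons h r =>
    simp only [SimpleGraph.Walk.snd_cons] at hsnd
    subst hsnd
    rw [T.cov_eq_of_isPath _ hq, T.cov_eq_of_isPath _ hq.of_cons]
    simp

theorem cov_of_isPath_of_notMem_support {u v c : V} (hc : T.graph.Adj u c) {q : T.graph.Walk u v}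
    (hq : q.IsPath) (hcq : c ∉ q.support) : T.cov c v = T.weight s(u, c) * T.cov u v := by
  rw [T.cov_eq_of_isPath _ (hq.cons (h := hc.symm) hcq), T.cov_eq_of_isPath _ hq]
  simp [Sym2.eq_swap]

open scoped Classical in
/-- The weight of a pair of nodes, which is `0` outside the edge set. -/
noncomputable def edgeWeight (e : Sym2 V) : ℝ :=
  if e ∈ T.graph.edgeSet then T.weight e else 0

variable {T} in
theorem edgeWeight_of_mem {e : Sym2 V} (he : e ∈ T.graph.edgeSet) :
    T.edgeWeight e = T.weight e := if_pos he

variable {T} in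
theorem edgeWeight_of_notMem {e : Sym2 V} (he : e ∉ T.graph.edgeSet) : T.edgeWeight e = 0 :=
  if_neg he

theorem abs_edgeWeight_lt_one (e : Sym2 V) : |T.edgeWeight e| < 1 := by
  unfold edgeWeight
  split_ifs with h
  · exact T.abs_weight_lt_one e h
  · simp

/-- The tree with the weight of `e` replaced by `0`. -/
noncomputable def cut [DecidableEq V] (e : Sym2 V) : GaussianTree V where
  graph := T.graph
  isTree := T.isTree
  weight := Function.update T.weight e 0
  abs_weight_lt_one f hf := by
    by_cases h : f = e
    · subst h; simp
    · rw [Function.update_of_ne h]; exact T.abs_weight_lt_one f hf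

theorem edgeWeight_cut [DecidableEq V] (e : Sym2 V) :
    (T.cut e).edgeWeight = Function.update T.edgeWeight e 0 := by
  funext f
  by_cases hf : f ∈ T.graph.edgeSet
  · rw [edgeWeight_of_mem (show f ∈ (T.cut e).graph.edgeSet from hf)]
    by_cases h : f = e
    · subst h
      simp [cut]
    · simp [cut, Function.update_of_ne h, edgeWeight_of_mem hf]
  · rw [edgeWeight_of_notMem (show f ∉ (T.cut e).graph.edgeSet from hf)]
    by_cases h : f = e
    · subst h
      simp
    · rw [Function.update_of_ne h, edgeWeight_of_notMem hf]

/-- A path through the cut edge has weight product `0`. Hence a covariance column of the cut tree is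
supported in one component, the source of all locality below. -/
theorem reachable_of_cov_cut_ne_zero [DecidableEq V] {a b u v : V}
    (h : (T.cut s(a, b)).cov u v ≠ 0) : (T.graph.deleteEdges {s(a, b)}).Reachable u v := by
  obtain ⟨q, hq, -⟩ := (T.cut s(a, b)).isTree.existsUnique_path u v
  rw [(T.cut s(a, b)).cov_eq_of_isPath q hq] at h
  rw [SimpleGraph.reachable_deleteEdges_iff_exists_walk]
  refine ⟨q, fun hmem => h (List.prod_eq_zero (List.mem_map.2 ⟨_, hmem, ?_⟩))⟩
  simp [cut]

theorem not_reachable_deleteEdges {x y : V} (h : T.graph.Adj x y) :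
    ¬ (T.graph.deleteEdges {s(x, y)}).Reachable x y :=
  SimpleGraph.isBridge_iff.1 (SimpleGraph.isAcyclic_iff_forall_adj_isBridge.1 T.isTree.isAcyclic h)

variable [Fintype V] [DecidableEq V]

theorem precisionOf_mul_cov : precisionOf T.edgeWeight * T.cov = 1 := by
  ext u v
  have hdiag : ∀ (c : V), ¬ T.graph.Adj u c → T.edgeWeight s(u, c) = 0 := fun c hc =>
    edgeWeight_of_notMem (by simpa using hc)
  have hexp : (precisionOf T.edgeWeight * T.cov) u v = T.cov u v +
      ∑ c, (T.edgeWeight s(u, c) ^ 2 / (1 - T.edgeWeight s(u, c) ^ 2) * T.cov u v -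
        T.edgeWeight s(u, c) / (1 - T.edgeWeight s(u, c) ^ 2) * T.cov c v) := by
    rw [precisionOf, Matrix.sub_mul, Matrix.sub_apply, Matrix.diagonal_mul, Matrix.mul_apply,
      Finset.sum_sub_distrib, ← Finset.sum_mul]
    simp only [Matrix.of_apply]
    ring
  rw [hexp]
  obtain ⟨q, hq, -⟩ := T.isTree.existsUnique_path u v
  -- For a neighbour `c` off the path from `u` to `v`, the path from `c` runs through `u`, and the
  -- two terms cancel. Only the next vertex on the path remains, and it cancels the leading `T.cov u
  -- v`.
  have hzero : ∀ c, c ∉ q.support →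
      T.edgeWeight s(u, c) ^ 2 / (1 - T.edgeWeight s(u, c) ^ 2) * T.cov u v -
        T.edgeWeight s(u, c) / (1 - T.edgeWeight s(u, c) ^ 2) * T.cov c v = 0 := by
    intro c hc
    by_cases hadj : T.graph.Adj u c
    · rw [T.cov_of_isPath_of_notMem_support hadj hq hc, edgeWeight_of_mem (by simpa using hadj)]
      ring
    · simp [hdiag c hadj]
  by_cases huv : u = v
  · subst huv
    rw [Finset.sum_eq_zero, cov_self]
    · simp
    · intro c _
      by_cases hcu : c = u
      · subst hcu; simp [hdiag c T.graph.irrefl]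
      · refine hzero c ?_
        rw [(SimpleGraph.Walk.nil_iff_support_eq.1 (SimpleGraph.Walk.isPath_iff_nil.1 hq))]
        simpa using hcu
  · have hnil : ¬ q.Nil := SimpleGraph.Walk.not_nil_of_ne huv
    have hadj := q.adj_snd hnil
    rw [Finset.sum_eq_single q.snd]
    · rw [T.cov_of_isPath_of_mem_support hadj hq (q.getVert_mem_support 1),
        edgeWeight_of_mem (by simpa using hadj), Matrix.one_apply_ne huv]
      have := (one_sub_sq_pos_of_abs_lt_one (T.abs_weight_lt_one s(u, q.snd)
        (by simpa using hadj))).ne'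
      field_simp
      ring
    · intro c _ hc
      by_cases hadj' : T.graph.Adj u c
      · exact hzero c fun hmem => hc (T.isTree.isAcyclic.eq_snd_of_adj_start hq hadj' hmem)
      · simp [hdiag c hadj']
    · simp

theorem inv_cov : T.cov⁻¹ = precisionOf T.edgeWeight :=
  Matrix.inv_eq_left_inv T.precisionOf_mul_cov

theorem precisionOf_mulVec_cov (x : V) :
    (precisionOf T.edgeWeight).mulVec (fun v => T.cov v x) = Pi.single x 1 := by
  ext u
  have := congrFun (congrFun T.precisionOf_mul_cov u) x
  rw [Matrix.mul_apply] at this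
  rw [Matrix.mulVec, dotProduct, this, Matrix.one_apply, Pi.single_apply]

/-- Induction on the number of nonzero weights: restoring a cut edge is a congruence, since its ends
are uncorrelated in the cut tree. -/
theorem precisionOf_posDef : (precisionOf T.edgeWeight).PosDef := by
  classical
  induction hn : (Finset.univ.filter fun e => T.edgeWeight e ≠ 0).card using Nat.strong_induction_on
    generalizing T with
  | _ n ih =>
  by_cases h : ∀ e, T.edgeWeight e = 0
  · have : precisionOf T.edgeWeight = 1 := by
      ext u v
      simp [precisionOf, h, Matrix.one_apply]
    rw [this]
    exact Matrix.PosDef.one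
  · push Not at h
    obtain ⟨e, he⟩ := h
    induction e with
    | _ x y =>
    have hxy : T.graph.Adj x y := by
      by_contra hc
      exact he (edgeWeight_of_notMem (by simpa using hc))
    rw [precisionOf_eq_update_add hxy.ne, ← edgeWeight_cut,
      posDef_add_edgeMatrix_iff (precisionOf_isSymm _)
        ((T.cut s(x, y)).precisionOf_mulVec_cov x) (cov_self _ _) ?_ (T.abs_edgeWeight_lt_one _)]
    · refine ih _ ?_ (T.cut s(x, y)) rfl
      rw [← hn]
      refine Finset.card_lt_card ⟨fun f hf => ?_, fun hsub => ?_⟩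
      · simp only [Finset.mem_filter, Finset.mem_univ, true_and, edgeWeight_cut] at hf ⊢
        by_cases hfe : f = s(x, y)
        · simpa [hfe] using he
        · rwa [Function.update_of_ne hfe] at hf
      · have := hsub (by simpa using he)
        simp [edgeWeight_cut] at this
    · by_contra hc
      exact T.not_reachable_deleteEdges hxy (T.reachable_of_cov_cut_ne_zero hc).symm

theorem cov_posDef : T.cov.PosDef := by
  have := T.precisionOf_posDef
  rw [← T.inv_cov] at this
  exact Matrix.posDef_inv_iff.1 this

end GaussianTree

/-! ### Bridges, components and sets with a single exit. -/

namespace SimpleGraph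

variable {V : Type*}

theorem Reachable.of_adj_imp_reachable {G H : SimpleGraph V}
    (h : ∀ u v, G.Adj u v → H.Reachable u v) {u v : V} (huv : G.Reachable u v) :
    H.Reachable u v := by
  obtain ⟨w⟩ := huv
  induction w with
  | nil => rfl
  | cons hadj _ ih => exact (h _ _ hadj).trans ih

theorem Connected.reachable_deleteEdges_or {G : SimpleGraph V} (hG : G.Connected) (x y v : V) :
    (G.deleteEdges {s(x, y)}).Reachable v x ∨ (G.deleteEdges {s(x, y)}).Reachable v y := by
  obtain ⟨w⟩ := hG.preconnected v x
  induction w with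
  | nil => exact Or.inl (Reachable.refl _)
  | @cons a b c hadj _ ih =>
    by_cases h : s(a, b) = s(c, y)
    · rcases Sym2.eq_iff.1 h with ⟨rfl, rfl⟩ | ⟨rfl, rfl⟩
      · exact Or.inl (Reachable.refl _)
      · exact Or.inr (Reachable.refl _)
    · have hab : (G.deleteEdges {s(c, y)}).Reachable a b :=
        Adj.reachable (deleteEdges_adj.2 ⟨hadj, by simpa using h⟩)
      exact ih.imp hab.trans hab.trans

theorem Reachable.exists_adj_boundary {G : SimpleGraph V} {S : Set V} {u v : V}
    (h : G.Reachable u v) (hu : u ∈ S) (hv : v ∉ S) :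
    ∃ a ∈ S, ∃ b ∉ S, G.Adj a b ∧ G.Reachable u a := by
  obtain ⟨w⟩ := h
  obtain ⟨d, -, hd, hd'⟩ := w.exists_boundary_dart {a | a ∈ S ∧ G.Reachable u a}
    ⟨hu, Reachable.refl _⟩ fun hc => hv hc.1
  exact ⟨d.fst, hd.1, d.snd, fun hS => hd' ⟨hS, hd.2.trans d.adj.reachable⟩, d.adj, hd.2⟩

theorem Connected.reachable_deleteEdges_of_induce {G : SimpleGraph V} {S : Set V}
    (hS : (G.induce S).Connected) {u v : V} (hu : u ∈ S) (hv : v ∈ S) {x y : V}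
    (hxy : ¬ (x ∈ S ∧ y ∈ S)) : (G.deleteEdges {s(x, y)}).Reachable u v := by
  have hreach := hS.preconnected ⟨u, hu⟩ ⟨v, hv⟩
  let f : G.induce S →g G.deleteEdges {s(x, y)} :=
    { toFun := Subtype.val
      map_rel' := fun {a b} hab => by
        refine deleteEdges_adj.2 ⟨hab, fun hmem => hxy ?_⟩
        rcases Sym2.eq_iff.1 (Set.mem_singleton_iff.1 hmem) with ⟨h₁, h₂⟩ | ⟨h₁, h₂⟩
        · exact ⟨h₁ ▸ a.2, h₂ ▸ b.2⟩
        · exact ⟨h₂ ▸ b.2, h₁ ▸ a.2⟩ }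
  exact hreach.map f

/-- At most one edge of `G` leaves the set `S`. -/
def HasAtMostOneExit (G : SimpleGraph V) (S : Set V) : Prop :=
  ∀ u ∈ S, ∀ u' ∈ S, ∀ c ∉ S, ∀ c' ∉ S, G.Adj u c → G.Adj u' c' → u = u' ∧ c = c'

/-- If at most one edge leaves `S`, then deleting an edge that meets `S` from `G` leaves one of
its ends with a component inside `S`. -/
theorem HasAtMostOneExit.component_subset {G : SimpleGraph V} {S : Set V}
    (hS : G.HasAtMostOneExit S) {i p : V} (hadj : G.Adj i p) (hp : p ∈ S)
    (hbr : ¬ (G.deleteEdges {s(i, p)}).Reachable i p) :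
    (∀ v, (G.deleteEdges {s(i, p)}).Reachable v i → v ∈ S) ∨
      ∀ v, (G.deleteEdges {s(i, p)}).Reachable v p → v ∈ S := by
  by_contra! hcon
  obtain ⟨⟨v, hvi, hv⟩, v', hvp, hv'⟩ := hcon
  obtain ⟨a, ha, b, hb, hab, hpa⟩ := hvp.symm.exists_adj_boundary hp hv'
  have hab' := deleteEdges_adj.1 hab
  -- If `i ∈ S`, both components would leave `S` by the same edge and hence coincide. Otherwise the
  -- only exit is the deleted edge itself.
  by_cases hi : i ∈ S
  · obtain ⟨a', ha', b', hb', hab'', hia⟩ := hvi.symm.exists_adj_boundary hi hv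
    have := (hS a ha a' ha' b hb b' hb' hab'.1 (deleteEdges_adj.1 hab'').1).1
    subst this
    exact hbr (hia.trans hpa.symm)
  · obtain ⟨rfl, rfl⟩ := hS a ha p hp b hb i hi hab'.1 hadj.symm
    exact hab'.2 (by simp [Sym2.eq_swap])

end SimpleGraph

/-- Every exit leads to the center. Two different exits would close a cycle through the connected
sets `L a` and `C`. -/
theorem IsStarDecomposition.hasAtMostOneExit {V : Type*} {G : SimpleGraph V} {C : Set V} {m : ℕ}
    {L : Fin m → Set V} (h : IsStarDecomposition G C L) (hG : G.IsAcyclic) (a : Fin m) :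
    G.HasAtMostOneExit (L a) := by
  have hC : ∀ u ∈ L a, ∀ c ∉ L a, G.Adj u c → c ∈ C := by
    intro u hu c hc hadj
    have hmem : c ∈ C ∪ ⋃ a, L a := h.cover ▸ Set.mem_univ c
    rcases hmem with hmem | hmem
    · exact hmem
    · obtain ⟨b, hb⟩ := Set.mem_iUnion.1 hmem
      by_cases hab : a = b
      · subst hab; exact absurd hb hc
      · exact absurd hadj (h.leaf_not_adj a b hab u hu c hb)
  intro u hu u' hu' c hc c' hc' hadj hadj'
  by_contra hne
  refine SimpleGraph.isBridge_iff.1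
    (SimpleGraph.isAcyclic_iff_forall_adj_isBridge.1 hG hadj) ?_
  have h₁ : (G.deleteEdges {s(u, c)}).Reachable u u' :=
    (h.leaf_connected a).reachable_deleteEdges_of_induce hu hu' fun hh => hc hh.2
  have h₂ : (G.deleteEdges {s(u, c)}).Reachable c' c :=
    h.center_connected.reachable_deleteEdges_of_induce (hC _ hu' _ hc' hadj') (hC _ hu _ hc hadj)
      fun hh => Set.disjoint_left.1 (h.center_disjoint a) hh.1 hu
  refine h₁.trans (SimpleGraph.Reachable.trans (SimpleGraph.Adj.reachable ?_) h₂)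
  refine SimpleGraph.deleteEdges_adj.2 ⟨hadj', fun hmem => ?_⟩
  rcases Sym2.eq_iff.1 (Set.mem_singleton_iff.1 hmem) with ⟨e₁, e₂⟩ | ⟨e₁, -⟩
  · exact hne ⟨e₁.symm, e₂.symm⟩
  · exact hc (e₁ ▸ hu')

/-! ### A single grafting operation. -/

namespace GaussianTree

variable {V : Type*} {T T' : GaussianTree V} {i p q : V}

namespace IsGrafting

/-- Otherwise every edge of `T'` joins nodes connected in `T` without `i — p`, and connectedness of
`T'` contradicts that `i — p` is a bridge. -/
theorem not_reachable (h : T.IsGrafting T' i p q) :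
    ¬ (T.graph.deleteEdges {s(i, p)}).Reachable i q := by
  intro hiq
  refine T.not_reachable_deleteEdges h.adj
    ((T'.isTree.connected.preconnected i p).of_adj_imp_reachable fun u v huv => ?_)
  have hmem : s(u, v) ∈ insert s(i, q) (T.graph.edgeSet \ {s(i, p)}) := h.edgeSet_eq ▸ huv
  rcases hmem with hmem | hmem
  · rcases Sym2.eq_iff.1 hmem with ⟨rfl, rfl⟩ | ⟨rfl, rfl⟩
    · exact hiq
    · exact hiq.symm
  · exact SimpleGraph.Adj.reachable (SimpleGraph.deleteEdges_adj.2 hmem)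

theorem reachable (h : T.IsGrafting T' i p q) :
    (T.graph.deleteEdges {s(i, p)}).Reachable q p :=
  (T.isTree.connected.reachable_deleteEdges_or i p q).resolve_left fun hc =>
    h.not_reachable hc.symm

theorem new_ne_old (h : T.IsGrafting T' i p q) : s(i, q) ≠ s(i, p) := fun hc =>
  h.ne (Sym2.congr_right.1 hc).symm

theorem new_notMem (h : T.IsGrafting T' i p q) : s(i, q) ∉ T.graph.edgeSet := fun hmem =>
  h.not_reachable (SimpleGraph.Adj.reachable
    (SimpleGraph.deleteEdges_adj.2 ⟨hmem, by simpa using h.new_ne_old⟩))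

theorem mem_edgeSet_iff (h : T.IsGrafting T' i p q) {e : Sym2 V} (hp : e ≠ s(i, p))
    (hq : e ≠ s(i, q)) : e ∈ T'.graph.edgeSet ↔ e ∈ T.graph.edgeSet := by
  simp [h.edgeSet_eq, hp, hq]

theorem edgeWeight_of_ne (h : T.IsGrafting T' i p q) {e : Sym2 V} (hp : e ≠ s(i, p))
    (hq : e ≠ s(i, q)) : T'.edgeWeight e = T.edgeWeight e := by
  by_cases he : e ∈ T.graph.edgeSet
  · rw [edgeWeight_of_mem he, edgeWeight_of_mem ((h.mem_edgeSet_iff hp hq).2 he),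
      h.weight_eq e he hp]
  · rw [edgeWeight_of_notMem he, edgeWeight_of_notMem (mt (h.mem_edgeSet_iff hp hq).1 he)]

theorem edgeWeight_new (h : T.IsGrafting T' i p q) :
    T'.edgeWeight s(i, q) = T.edgeWeight s(i, p) := by
  rw [edgeWeight_of_mem (show s(i, p) ∈ T.graph.edgeSet from h.adj),
    edgeWeight_of_mem (by simp [h.edgeSet_eq]), h.weight_new]

theorem edgeWeight_old (h : T.IsGrafting T' i p q) : T'.edgeWeight s(i, p) = 0 :=
  edgeWeight_of_notMem (by simp [h.edgeSet_eq, h.new_ne_old.symm])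

theorem update_edgeWeight_eq [DecidableEq V] (h : T.IsGrafting T' i p q) :
    Function.update T'.edgeWeight s(i, q) 0 = Function.update T.edgeWeight s(i, p) 0 := by
  funext e
  by_cases hq : e = s(i, q)
  · subst hq
    rw [Function.update_self, Function.update_of_ne h.new_ne_old,
      edgeWeight_of_notMem h.new_notMem]
  · rw [Function.update_of_ne hq]
    by_cases hp : e = s(i, p)
    · subst hp
      rw [Function.update_self, h.edgeWeight_old]
    · rw [Function.update_of_ne hp, h.edgeWeight_of_ne hp hq]

variable [Fintype V] [DecidableEq V]

/-- The two precision matrices of a grafting operation that takes place at a set `S` with at most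
one exit are `X + K` and `X + K'`, where `X` lies in a convex set that contains the remainder of
every tree with the same edges at `S`, and on which adding `K` and adding `K'` have the same
effect on positive definiteness and on the determinant. -/
theorem exists_convex_remainders (h : T.IsGrafting T' i p q) {S : Set V} (hp : p ∈ S)
    (hS : T.graph.HasAtMostOneExit S) :
    ∃ (R : Set (Matrix V V ℝ)) (K K' : Matrix V V ℝ), Convex ℝ R ∧
      (∀ X ∈ R, (X + K).PosDef ↔ (X + K').PosDef) ∧ (∀ X ∈ R, (X + K).det = (X + K').det) ∧
      (∀ U : GaussianTree V, (∀ v ∈ S, ∀ u, U.edgeWeight s(v, u) = T.edgeWeight s(v, u)) →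
        precisionOf U.edgeWeight - K ∈ R) ∧
      (∀ U : GaussianTree V, (∀ v ∈ S, ∀ u, U.edgeWeight s(v, u) = T'.edgeWeight s(v, u)) →
        precisionOf U.edgeWeight - K' ∈ R) ∧
      precisionOf T'.edgeWeight - precisionOf T.edgeWeight = K' - K := by
  set H := T.graph.deleteEdges {s(i, p)} with hH
  set w := T.edgeWeight s(i, p) with hw
  have hw1 : |w| < 1 := T.abs_edgeWeight_lt_one _
  -- Orient the old and the new edge so that `x` and `x'` lie in the component contained in `S`:
  -- either both are `i`, or they are `p` and `q`.
  obtain ⟨x, y, x', y', hxy, hxy', hx, hx', hnr, hnr'⟩ : ∃ x y x' y', s(x, y) = s(i, p) ∧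
      s(x', y') = s(i, q) ∧ (∀ v, H.Reachable v x → v ∈ S) ∧ (∀ v, H.Reachable v x' → v ∈ S) ∧
      ¬ H.Reachable y x ∧ ¬ H.Reachable y' x' := by
    have hbr := T.not_reachable_deleteEdges h.adj
    rcases hS.component_subset h.adj hp hbr with hc | hc
    · exact ⟨i, p, i, q, rfl, rfl, hc, hc, fun hh => hbr hh.symm,
        fun hh => h.not_reachable hh.symm⟩
    · exact ⟨p, i, q, i, Sym2.eq_swap, Sym2.eq_swap, hc, fun v hv => hc v (hv.trans h.reachable),
        hbr, h.not_reachable⟩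
  have hxne : x ≠ y := by rintro rfl; exact hnr (SimpleGraph.Reachable.refl _)
  have hxne' : x' ≠ y' := by rintro rfl; exact hnr' (SimpleGraph.Reachable.refl _)
  have hxS : x ∈ S := hx x (SimpleGraph.Reachable.refl _)
  have hxS' : x' ∈ S := hx' x' (SimpleGraph.Reachable.refl _)
  set g : V → V → ℝ := fun z v => (T.cut s(i, p)).cov v z with hg
  have hgone : ∀ z, g z z = 1 := fun z => cov_self _ z
  have hgsupp : ∀ z v, g z v ≠ 0 → H.Reachable v z := fun z v hv =>
    T.reachable_of_cov_cut_ne_zero hv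
  have hgy : g x y = 0 := by_contra fun hc => hnr (hgsupp _ _ hc)
  have hgy' : g x' y' = 0 := by_contra fun hc => hnr' (hgsupp _ _ hc)
  -- Affine conditions, hence convex. Since `g x` and `g x'` are supported in `S`, only the weights
  -- of pairs meeting `S` enter them.
  set R : Set (Matrix V V ℝ) := {X | X.IsSymm ∧ X.mulVec (g x) = Pi.single x 1 ∧
    X.mulVec (g x') = Pi.single x' 1} with hR
  have hmem : ∀ (ω : Sym2 V → ℝ), (∀ v ∈ S, ∀ u,
      ω s(v, u) = Function.update T.edgeWeight s(i, p) 0 s(v, u)) → precisionOf ω ∈ R := by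
    intro ω hω
    refine ⟨precisionOf_isSymm _, ?_, ?_⟩
    · rw [← (T.cut s(i, p)).precisionOf_mulVec_cov x]
      refine precisionOf_mulVec_congr fun v hv u => ?_
      rw [edgeWeight_cut, hω v (hx v (hgsupp _ _ hv))]
    · rw [← (T.cut s(i, p)).precisionOf_mulVec_cov x']
      refine precisionOf_mulVec_congr fun v hv u => ?_
      rw [edgeWeight_cut, hω v (hx' v (hgsupp _ _ hv))]
  refine ⟨R, edgeMatrix x y w, edgeMatrix x' y' w, ?_, ?_, ?_, ?_, ?_, ?_⟩
  · rintro X ⟨hX₁, hX₂, hX₃⟩ Y ⟨hY₁, hY₂, hY₃⟩ s t - - hst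
    refine ⟨(hX₁.smul s).add (hY₁.smul t), ?_, ?_⟩
    · rw [Matrix.add_mulVec, Matrix.smul_mulVec, Matrix.smul_mulVec, hX₂, hY₂, ← add_smul, hst,
        one_smul]
    · rw [Matrix.add_mulVec, Matrix.smul_mulVec, Matrix.smul_mulVec, hX₃, hY₃, ← add_smul, hst,
        one_smul]
  · rintro X ⟨hX₁, hX₂, hX₃⟩
    rw [posDef_add_edgeMatrix_iff hX₁ hX₂ (hgone x) hgy hw1,
      posDef_add_edgeMatrix_iff hX₁ hX₃ (hgone x') hgy' hw1]
  · rintro X ⟨hX₁, hX₂, hX₃⟩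
    rw [det_add_edgeMatrix hX₁ hX₂ (hgone x) hgy hw1,
      det_add_edgeMatrix hX₁ hX₃ (hgone x') hgy' hw1]
  · intro U hU
    rw [precisionOf_eq_update_add hxne, hU x hxS y, hxy, ← hw, add_sub_cancel_right]
    refine hmem _ fun v hv u => ?_
    simp only [Function.update_apply, hU v hv u]
  · intro U hU
    rw [precisionOf_eq_update_add hxne', hU x' hxS' y', hxy', h.edgeWeight_new, ← hw,
      add_sub_cancel_right]
    refine hmem _ fun v hv u => ?_
    rw [← h.update_edgeWeight_eq]
    simp only [Function.update_apply, hU v hv u]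
  · rw [precisionOf_eq_update_add hxne T.edgeWeight, precisionOf_eq_update_add hxne' T'.edgeWeight,
      hxy, hxy', h.update_edgeWeight_eq, h.edgeWeight_new, ← hw]
    abel

end IsGrafting

end GaussianTree

/-! ### Independence along the chain and monotonicity. -/

theorem InvolvesSuperLeaves.notMem {V : Type*} {C : Set V} {m : ℕ} {L : Fin m → Set V} {i p q : V}
    {A : Set (Fin m)} (h : InvolvesSuperLeaves C L i p q A) (hC : ∀ a, Disjoint C (L a))
    (hL : ∀ a b, a ≠ b → Disjoint (L a) (L b)) {a : Fin m} (ha : a ∉ A) :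
    i ∉ L a ∧ p ∉ L a ∧ q ∉ L a := by
  have key : ∀ {b v}, v ∈ L b → b ≠ a → v ∉ L a := fun hv hb =>
    Set.disjoint_left.1 (hL _ _ hb) hv
  cases h with
  | within b hi hp hq =>
    have hb : b ≠ a := fun e => ha (by simp [e])
    exact ⟨key hi hb, key hp hb, key hq hb⟩
  | outside b hi hp hq =>
    have hb : b ≠ a := fun e => ha (by simp [e])
    exact ⟨Set.disjoint_left.1 (hC a) hi, key hp hb, key hq hb⟩
  | between b c hbc hi hp hq =>
    have hb : b ≠ a := fun e => ha (by simp [e])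
    have hc : c ≠ a := fun e => ha (by simp [e])
    exact ⟨key hi hb, key hp hb, key hq hc⟩

theorem InvolvesSuperLeaves.exists_mem {V : Type*} {C : Set V} {m : ℕ} {L : Fin m → Set V}
    {i p q : V} {A : Set (Fin m)} (h : InvolvesSuperLeaves C L i p q A) : ∃ a ∈ A, p ∈ L a := by
  cases h with
  | within a hi hp hq => exact ⟨a, by simp, hp⟩
  | outside a hi hp hq => exact ⟨a, by simp, hp⟩
  | between a b hab hi hp hq => exact ⟨a, by simp, hp⟩

theorem Fin.rel_of_rel_succ {n : ℕ} {r : Fin (n + 1) → Fin (n + 1) → Prop} (hrefl : ∀ j, r j j)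
    (htrans : ∀ a b c, r a b → r b c → r a c) {p q : Fin (n + 1)} (hpq : p ≤ q)
    (h : ∀ k : Fin n, p ≤ k.castSucc → k.succ ≤ q → r k.castSucc k.succ) : r p q := by
  induction q using Fin.induction with
  | zero => rw [Fin.le_zero_iff.1 hpq]; exact hrefl _
  | succ k ih =>
    rcases hpq.eq_or_lt with rfl | hlt
    · exact hrefl _
    · have hpk : p ≤ k.castSucc := Fin.le_castSucc_iff.2 hlt
      exact htrans _ _ _ (ih hpk fun l hl hl' =>
        h l hl (hl'.trans (Fin.castSucc_lt_succ).le)) (h k hpk le_rfl)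

section Chain

variable {V : Type*} {n : ℕ} {T : Fin (n + 1) → GaussianTree V}

/-- Take for `S` the super leaf node containing `p`. No other operation involves it, so the edges at
`S` change only at step `k`. An operation between two super leaf nodes needs only this one, since `q
∈ S` is not required. -/
theorem IsIndependentGraftingChain.exists_local (hT : IsIndependentGraftingChain T) (k : Fin n) :
    ∃ (i p q : V) (S : Set V), (T k.castSucc).IsGrafting (T k.succ) i p q ∧ p ∈ S ∧
      (T k.castSucc).graph.HasAtMostOneExit S ∧
      (∀ j ≤ k.castSucc, ∀ v ∈ S, ∀ u,
        (T j).edgeWeight s(v, u) = (T k.castSucc).edgeWeight s(v, u)) ∧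
      ∀ j, k.succ ≤ j → ∀ v ∈ S, ∀ u,
        (T j).edgeWeight s(v, u) = (T k.succ).edgeWeight s(v, u) := by
  obtain ⟨m, C, L, A, hstar, hA, hop⟩ := hT
  obtain ⟨i, p, q, hgr, hinv⟩ := hop k
  obtain ⟨a, haA, hpa⟩ := hinv.exists_mem
  have hne : ∀ l : Fin n, l ≠ k → ∃ i' p' q', (T l.castSucc).IsGrafting (T l.succ) i' p' q' ∧
      ∀ v ∈ L a, ∀ u, s(v, u) ≠ s(i', p') ∧ s(v, u) ≠ s(i', q') := by
    intro l hl
    obtain ⟨i', p', q', hgr', hinv'⟩ := hop l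
    have hal : a ∉ A l := fun hal => Set.disjoint_left.1 (hA l k hl) hal haA
    obtain ⟨h₁, h₂, h₃⟩ := hinv'.notMem hstar.center_disjoint hstar.leaf_disjoint hal
    have key : ∀ v ∈ L a, ∀ u x y, x ∉ L a → y ∉ L a → s(v, u) ≠ s(x, y) := by
      intro v hv u x y hx hy hc
      have hmem : v ∈ s(x, y) := hc ▸ Sym2.mem_mk_left v u
      rcases Sym2.mem_iff.1 hmem with rfl | rfl
      · exact hx hv
      · exact hy hv
    exact ⟨i', p', q', hgr', fun v hv u => ⟨key v hv u _ _ h₁ h₂, key v hv u _ _ h₁ h₃⟩⟩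
  have hweight : ∀ l : Fin n, l ≠ k → ∀ v ∈ L a, ∀ u,
      (T l.castSucc).edgeWeight s(v, u) = (T l.succ).edgeWeight s(v, u) := by
    intro l hl v hv u
    obtain ⟨i', p', q', hgr', h'⟩ := hne l hl
    exact (hgr'.edgeWeight_of_ne (h' v hv u).1 (h' v hv u).2).symm
  refine ⟨i, p, q, L a, hgr, hpa, ?_, fun j hj v hv u => ?_, fun j hj v hv u => ?_⟩
  · have hadj : ∀ v ∈ L a, ∀ u, (T 0).graph.Adj v u ↔ (T k.castSucc).graph.Adj v u := by
      intro v hv u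
      refine Fin.rel_of_rel_succ
        (r := fun j j' => (T j).graph.Adj v u ↔ (T j').graph.Adj v u) (fun _ => Iff.rfl)
        (fun _ _ _ => Iff.trans) (Fin.zero_le _) fun l _ hl => ?_
      obtain ⟨i', p', q', hgr', h'⟩ := hne l (by
        rintro rfl
        exact absurd hl (not_le.2 Fin.castSucc_lt_succ))
      exact (hgr'.mem_edgeSet_iff (h' v hv u).1 (h' v hv u).2).symm
    have h0 := hstar.hasAtMostOneExit (T 0).isTree.isAcyclic a
    intro u hu u' hu' c hc c' hc' huc huc'
    exact h0 u hu u' hu' c hc c' hc' ((hadj u hu c).2 huc) ((hadj u' hu' c').2 huc')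
  · refine Fin.rel_of_rel_succ
      (r := fun j j' => (T j).edgeWeight s(v, u) = (T j').edgeWeight s(v, u)) (fun _ => rfl)
      (fun _ _ _ => Eq.trans) hj fun l _ hl => hweight l ?_ v hv u
    rintro rfl
    exact absurd hl (not_le.2 Fin.castSucc_lt_succ)
  · refine (Fin.rel_of_rel_succ
      (r := fun j j' => (T j).edgeWeight s(v, u) = (T j').edgeWeight s(v, u)) (fun _ => rfl)
      (fun _ _ _ => Eq.trans) hj fun l hl _ => hweight l ?_ v hv u).symm
    rintro rfl
    exact absurd hl (not_le.2 Fin.castSucc_lt_succ)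

variable [Fintype V] [DecidableEq V]

/-- The decomposition `GaussianTree.IsGrafting.exists_convex_remainders` for one operation of the
chain holds for all earlier trees with `K`, and for all later trees with `K'`. -/
theorem IsIndependentGraftingChain.exists_convex_remainders (hT : IsIndependentGraftingChain T)
    (k : Fin n) :
    ∃ (R : Set (Matrix V V ℝ)) (K K' : Matrix V V ℝ), Convex ℝ R ∧
      (∀ X ∈ R, (X + K).PosDef ↔ (X + K').PosDef) ∧ (∀ X ∈ R, (X + K).det = (X + K').det) ∧
      (∀ j ≤ k.castSucc, precisionOf (T j).edgeWeight - K ∈ R) ∧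
      (∀ j, k.succ ≤ j → precisionOf (T j).edgeWeight - K' ∈ R) ∧
      precisionOf (T k.succ).edgeWeight - precisionOf (T k.castSucc).edgeWeight = K' - K := by
  obtain ⟨i, p, q, S, hgr, hp, hS, hle, hge⟩ := hT.exists_local k
  obtain ⟨R, K, K', h₁, h₂, h₃, h₄, h₅, h₆⟩ := hgr.exists_convex_remainders hp hS
  exact ⟨R, K, K', h₁, h₂, h₃, fun j hj => h₄ _ (hle j hj), fun j hj => h₅ _ (hge j hj), h₆⟩

theorem IsIndependentGraftingChain.det_succ (hT : IsIndependentGraftingChain T) (k : Fin n) :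
    (precisionOf (T k.castSucc).edgeWeight).det = (precisionOf (T k.succ).edgeWeight).det := by
  obtain ⟨R, K, K', -, -, hdet, hle, -, hdiff⟩ := hT.exists_convex_remainders k
  have h := hdet _ (hle _ le_rfl)
  rwa [sub_add_cancel, sub_add_eq_add_sub, add_sub_assoc, ← hdiff, add_sub_cancel] at h

theorem IsIndependentGraftingChain.det_eq (hT : IsIndependentGraftingChain T)
    (i j : Fin (n + 1)) :
    (precisionOf (T i).edgeWeight).det = (precisionOf (T j).edgeWeight).det := by
  have h0 : ∀ j, (precisionOf (T 0).edgeWeight).det = (precisionOf (T j).edgeWeight).det :=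
    fun j => Fin.rel_of_rel_succ (r := fun j j' =>
      (precisionOf (T j).edgeWeight).det = (precisionOf (T j').edgeWeight).det) (fun _ => rfl)
      (fun _ _ _ => Eq.trans) (Fin.zero_le _) fun k _ _ => hT.det_succ k
  rw [← h0 i, ← h0 j]

theorem IsIndependentGraftingChain.det_le_succ_right (hT : IsIndependentGraftingChain T)
    {i : Fin (n + 1)} {k : Fin n} (hik : i ≤ k.castSucc) {l : ℝ} (hl : l ∈ Set.Icc (0 : ℝ) 1) :
    (l • precisionOf (T i).edgeWeight + (1 - l) • precisionOf (T k.castSucc).edgeWeight).det ≤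
      (l • precisionOf (T i).edgeWeight + (1 - l) • precisionOf (T k.succ).edgeWeight).det := by
  obtain ⟨R, K, K', hconv, hpd, hdet, hle, -, hdiff⟩ := hT.exists_convex_remainders k
  set P := precisionOf (T i).edgeWeight
  set Q := precisionOf (T k.castSucc).edgeWeight
  set Q' := precisionOf (T k.succ).edgeWeight
  have hX : l • (P - K) + (1 - l) • (Q - K) ∈ R :=
    hconv (hle i hik) (hle _ le_rfl) hl.1 (sub_nonneg.2 hl.2) (by ring)
  set X := l • (P - K) + (1 - l) • (Q - K) with hXdef
  have e : l • P + (1 - l) • Q = X + K := by rw [hXdef]; module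
  have hQ' : Q' = Q + (K' - K) := by rw [← hdiff]; abel
  have e' : l • P + (1 - l) • Q' = l • (X + K) + (1 - l) • (X + K') := by
    -- Only tree `k` changes, so the share `1 - l` of `K` is exchanged for `K'` while `X` is kept.
    rw [hXdef, hQ']; module
  have hXK : (X + K).PosDef :=
    e ▸ (T i).precisionOf_posDef.convexComb (T k.castSucc).precisionOf_posDef hl
  rw [e', e]
  exact hXK.det_le_det_convexComb ((hpd X hX).1 hXK) (hdet X hX) hl

/-- The mirror image: trees after the operation all contain `K'`, and stepping back at the left end
exchanges the share `l` of `K'` for `K`. -/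
theorem IsIndependentGraftingChain.det_le_castSucc_left (hT : IsIndependentGraftingChain T)
    {j : Fin (n + 1)} {k : Fin n} (hkj : k.succ ≤ j) {l : ℝ} (hl : l ∈ Set.Icc (0 : ℝ) 1) :
    (l • precisionOf (T k.succ).edgeWeight + (1 - l) • precisionOf (T j).edgeWeight).det ≤
      (l • precisionOf (T k.castSucc).edgeWeight + (1 - l) • precisionOf (T j).edgeWeight).det := by
  obtain ⟨R, K, K', hconv, hpd, hdet, -, hge, hdiff⟩ := hT.exists_convex_remainders k
  set P := precisionOf (T j).edgeWeight
  set Q := precisionOf (T k.castSucc).edgeWeight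
  set Q' := precisionOf (T k.succ).edgeWeight
  have hX : l • (Q' - K') + (1 - l) • (P - K') ∈ R :=
    hconv (hge _ le_rfl) (hge j hkj) hl.1 (sub_nonneg.2 hl.2) (by ring)
  set X := l • (Q' - K') + (1 - l) • (P - K') with hXdef
  have e : l • Q' + (1 - l) • P = X + K' := by rw [hXdef]; module
  have hQ : Q = Q' - (K' - K) := by rw [← hdiff]; abel
  have e' : l • Q + (1 - l) • P = l • (X + K) + (1 - l) • (X + K') := by
    rw [hXdef, hQ]; module
  have hXK : (X + K').PosDef :=
    e ▸ (T k.succ).precisionOf_posDef.convexComb (T j).precisionOf_posDef hl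
  have hXK' := (hpd X hX).2 hXK
  rw [e', e, ← hdet X hX]
  exact hXK'.det_le_det_convexComb hXK (hdet X hX) hl

/-- All trees of the chain have the same determinant, so the exponents differ only in the
determinant of the mixture. -/
theorem IsIndependentGraftingChain.chernoffInfo_le (hT : IsIndependentGraftingChain T)
    {i j p q : Fin (n + 1)}
    (h : ∀ l ∈ Set.Icc (0 : ℝ) 1,
      (l • precisionOf (T i).edgeWeight + (1 - l) • precisionOf (T j).edgeWeight).det ≤
        (l • precisionOf (T p).edgeWeight + (1 - l) • precisionOf (T q).edgeWeight).det) :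
    chernoffInfo (T i).cov (T j).cov ≤ chernoffInfo (T p).cov (T q).cov := by
  refine chernoffInfo_le_of_exponent_le (T i).cov_posDef (T j).cov_posDef (T p).cov_posDef
    (T q).cov_posDef fun l hl => ?_
  simp only [GaussianTree.inv_cov, chernoffExponent]
  rw [hT.det_eq i 0, hT.det_eq j 0, hT.det_eq p 0, hT.det_eq q 0]
  have := Real.log_le_log
    ((T i).precisionOf_posDef.convexComb (T j).precisionOf_posDef hl).det_pos (h l hl)
  linarith

end Chain

/-- In a chain of independent grafting operations, all pairwise Chernoff informations are well
defined, and they are monotone with respect to inclusion of the index intervals. -/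
theorem mainTheorem3 {V : Type*} [Fintype V] [DecidableEq V] (n : ℕ)
    (T : Fin (n + 1) → GaussianTree V) (hT : IsIndependentGraftingChain T) :
    (∀ i j : Fin (n + 1), ∃! c : ℝ, IsChernoffInfo (T i).cov (T j).cov c) ∧
    ∀ p i j q : Fin (n + 1), p ≤ i → i ≤ j → j ≤ q →
      chernoffInfo (T i).cov (T j).cov ≤ chernoffInfo (T p).cov (T q).cov := by
  refine ⟨fun i j => existsUnique_isChernoffInfo (T i).cov_posDef (T j).cov_posDef,
    fun p i j q hpi hij hjq => le_trans (b := chernoffInfo (T i).cov (T q).cov) ?_ ?_⟩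
  · exact Fin.rel_of_rel_succ (r := fun a b => chernoffInfo (T i).cov (T a).cov ≤
      chernoffInfo (T i).cov (T b).cov) (fun _ => le_rfl) (fun _ _ _ => le_trans) hjq
      fun k hk _ => hT.chernoffInfo_le fun l hl => hT.det_le_succ_right (hij.trans hk) hl
  · exact Fin.rel_of_rel_succ (r := fun a b => chernoffInfo (T b).cov (T q).cov ≤
      chernoffInfo (T a).cov (T q).cov) (fun _ => le_rfl) (fun _ _ _ h h' => le_trans h' h) hpi
      fun k _ hk => hT.chernoffInfo_le fun l hl =>
        hT.det_le_castSucc_left (hk.trans (hij.trans hjq)) hl
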